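/- **Conventions.** A partition is identified with its Young diagram, whose nodes $(k,l)$ are indexed by row $k\ge 1$ and column $l\ge 1$. The hooks of a partition $\mu$ are indexed by the nodes of $\mu$; $H(\mu)$ is the set of hooks, $h(z)$ is the (usual) length of the hook $z$, and $\mathcal H(\mu)$ is the multiset of all hook lengths of $\mu$. For a positive integer $d$, the $d$-residue of a node $(k,l)$ is the remainder of $l-k$ modulo $d$. The hand residue of the hook at $(k,l)$ is the $d$-residue of the last node of row $k$, and its foot residue is the $d$-residue of the bottom node of column $l$. The $d$-core $\mu_{(d)}$ is the partition obtained from $\mu$ by removing hooks of length $d$ (more precisely, the corresponding rim hooks) until there is none left. A $\beta$-set is a finite set $X=\{a_1>a_2>\dots>a_t\}$ of non-negative integers. The partition $p(X)$ has as its parts the non-zero ones among the numbers $a_i-(t-i)$, $1\le i\le t$; we call $X$ a $\beta$-set for $p(X)$. For $0\le j<d$ put $X_j^{(d)}=\{k\ge 0\mid j+kd\in X\}$. Let $r$ be the maximal number of parts of the partitions $p(X_0^{(d)}),\dots,p(X_{d-1}^{(d)})$, and let $Y_j$ be the $\beta$-set with exactly $r$ elements for $p(X_j^{(d)})$. Put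 $Q_d(X)=\{j+kd\mid 0\le j<d,\ k\in Y_j\}$. The $d$-quotient partition of $X$ is $q_d(X)=p(Q_d(X))$. **Theorem 4.7.** Let $d$ be a positive integer, $\lambda$ a partition, $X$ a $\beta$-set for $\lambda$, and $x_i=|X_i^{(d)}|$ for $0\le i<d$. Let $\lambda_X^{(d)}=q_d(X)$. For $z\in H(\lambda_X^{(d)})$ define the modified hook length $$\bar h(z)=h(z)+(x_i-x_j)\,d ,$$ where $i,j\in\{0,\dots,d-1\}$ are such that $z$ has hand residue $i$ and foot residue congruent to $j+1$ modulo $d$. Let $\overline{\mathcal H}(\lambda_X^{(d)})$ be the multiset of all $\bar h(z)$, $z\in H(\lambda_X^{(d)})$. Then, as multisets (the union adding multiplicities), $$\mathcal H(\lambda)=\mathcal H(\lambda_{(d)})\cup\{\,|h| : h\in\overline{\mathcal H}(\lambda_X^{(d)})\,\}.$$ -/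

import Mathlib

/- Partitions are Young diagrams, with rows and columns counted from `0`: the cell `(i, j)` lies in
row `i` and column `j`. The cells of a diagram also index its hooks. -/
namespace YoungDiagram

/-- The length of the hook of `μ` at the cell `c` of `μ`: arm length plus leg length plus one. -/
def hookLength (μ : YoungDiagram) (c : ℕ × ℕ) : ℕ :=
  (μ.rowLen c.1 - (c.2 + 1)) + (μ.colLen c.2 - (c.1 + 1)) + 1

/-- The multiset of all hook lengths of `μ`. -/
def hookLengths (μ : YoungDiagram) : Multiset ℕ :=
  μ.cells.val.map μ.hookLength

/-- The `d`-residue of a node: the remainder of (column minus row) modulo `d`. -/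
def residue (d : ℕ) (c : ℕ × ℕ) : ℕ :=
  (((c.2 : ℤ) - (c.1 : ℤ)) % (d : ℤ)).toNat

/-- The residue of the rightmost node in the row of the cell `c` of `μ`. -/
def handResidue (d : ℕ) (μ : YoungDiagram) (c : ℕ × ℕ) : ℕ :=
  residue d (c.1, μ.rowLen c.1 - 1)

/-- The residue of the bottom node in the column of the cell `c` of `μ`. -/
def footResidue (d : ℕ) (μ : YoungDiagram) (c : ℕ × ℕ) : ℕ :=
  residue d (μ.colLen c.2 - 1, c.2)

/-- Removal of the hook of `μ` at the cell `c`, i.e. of the part of the rim of `μ` that runs from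
the hand to the foot of that hook. A cell `(i, j)` of `μ` is on the rim if `(i + 1, j + 1)` is not
a cell of `μ`. -/
def removeHook (μ : YoungDiagram) (c : ℕ × ℕ) : YoungDiagram where
  cells := μ.cells.filter fun x => ¬ (c.1 ≤ x.1 ∧ c.2 ≤ x.2 ∧ (x.1 + 1, x.2 + 1) ∉ μ)
  isLowerSet := by
    rintro ⟨i, j⟩ ⟨i', j'⟩ ⟨h1, h2⟩ h
    simp only [Finset.coe_filter, mem_cells, Set.mem_ofPred_eq] at h h1 h2 ⊢
    refine ⟨μ.up_left_mem h1 h2 h.1, fun hr => h.2 ⟨hr.1.trans h1, hr.2.1.trans h2, fun hm => ?_⟩⟩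
    exact hr.2.2 (μ.up_left_mem (Nat.succ_le_succ h1) (Nat.succ_le_succ h2) hm)

/-- `ν` is obtained from `μ` by removing one hook of length `d`. -/
def RemovesHook (d : ℕ) (μ ν : YoungDiagram) : Prop :=
  ∃ c ∈ μ, μ.hookLength c = d ∧ ν = μ.removeHook c

/-- `κ` is the `d`-core of `μ`: it is obtained from `μ` by successively removing hooks of
length `d`, and it has no hook of length `d` itself. -/
def IsCore (d : ℕ) (μ κ : YoungDiagram) : Prop :=
  Relation.ReflTransGen (RemovesHook d) μ κ ∧ ∀ c ∈ κ, κ.hookLength c ≠ d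

theorem card_removeHook_lt {μ : YoungDiagram} {c : ℕ × ℕ} (hc : c ∈ μ) :
    (μ.removeHook c).card < μ.card := by
  apply Finset.card_lt_card
  refine Finset.filter_ssubset.2 ?_
  have hex : ∃ n, (c.1 + n, c.2 + n) ∉ μ := by
    refine ⟨μ.rowLen 0, fun h => ?_⟩
    have h0 : (0, c.2 + μ.rowLen 0) ∈ μ := μ.up_left_mem (Nat.zero_le _) le_rfl h
    rw [mem_iff_lt_rowLen] at h0
    omega
  classical
  have hn := Nat.find_spec hex
  have hmin := fun m => Nat.find_min hex (m := m)
  generalize Nat.find hex = n at hn hmin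
  cases n with
  | zero => exact absurd hc (by simpa using hn)
  | succ n =>
    refine ⟨(c.1 + n, c.2 + n), ?_, ?_⟩
    · simpa using hmin n (Nat.lt_succ_self n)
    · simpa [Nat.add_assoc] using hn

/-- Every partition has a `d`-core. -/
theorem exists_isCore (d : ℕ) (μ : YoungDiagram) : ∃ κ, IsCore d μ κ := by
  induction h : μ.card using Nat.strong_induction_on generalizing μ with
  | _ n ih =>
    by_cases hμ : ∀ c ∈ μ, μ.hookLength c ≠ d
    · exact ⟨μ, Relation.ReflTransGen.refl, hμ⟩
    · push Not at hμ
      obtain ⟨c, hc, hcd⟩ := hμ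
      obtain ⟨κ, hκ, hκ'⟩ := ih _ (h ▸ card_removeHook_lt hc) (μ.removeHook c) rfl
      exact ⟨κ, Relation.ReflTransGen.head ⟨c, hc, hcd, rfl⟩ hκ, hκ'⟩

end YoungDiagram

/- A `β`-set is a finite set of nonnegative integers; a `d`-symbol is a `d`-tuple of `β`-sets. -/
namespace BetaSet

/-- The number `a_i - (t - i)` for the element `a = a_i` of `X = {a_1 > a_2 > ... > a_t}`: here
`t - i` is the number of elements of `X` below `a_i`. -/
def part (X : Finset ℕ) (a : ℕ) : ℕ :=
  a - (X.filter (· < a)).card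

theorem part_mono (X : Finset ℕ) {a b : ℕ} (h : a ≤ b) : part X a ≤ part X b := by
  have h1 : (X.filter (· < b)).card ≤ (X.filter (· < a)).card + (b - a) := by
    have : X.filter (· < b) ⊆ X.filter (· < a) ∪ Finset.Ico a b := by
      intro x hx
      simp only [Finset.mem_filter, Finset.mem_union, Finset.mem_Ico] at hx ⊢
      rcases lt_or_ge x a with h | h
      · exact Or.inl ⟨hx.1, h⟩
      · exact Or.inr ⟨h, hx.2⟩
    calc _ ≤ _ := Finset.card_le_card this
      _ ≤ _ := Finset.card_union_le _ _
      _ = _ := by rw [Nat.card_Ico]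
  unfold part
  omega

/-- The partition `p(X)` of a `β`-set `X = {a_1 > a_2 > ... > a_t}`: its parts are the nonzero ones
among the numbers `a_i - (t - i)` (a zero in the list below contributes an empty row). -/
def partition (X : Finset ℕ) : YoungDiagram :=
  YoungDiagram.ofRowLens ((X.sort (· ≥ ·)).map (part X)) <| by
    rw [List.sortedGE_iff_pairwise, List.pairwise_map]
    exact (X.pairwise_sort (· ≥ ·)).imp fun h => part_mono X h

/-- The component `X_j = {k | j + k d ∈ X}` of a `β`-set `X` (for `0 < d`). -/
def component (d : ℕ) (X : Finset ℕ) (j : ℕ) : Finset ℕ :=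
  (Finset.range (X.sup id + 1)).filter fun k => j + k * d ∈ X

theorem mem_component {d : ℕ} (hd : 0 < d) {X : Finset ℕ} {j k : ℕ} :
    k ∈ component d X j ↔ j + k * d ∈ X := by
  simp only [component, Finset.mem_filter, Finset.mem_range, and_iff_right_iff_imp]
  intro h
  have h1 : j + k * d ≤ X.sup id := Finset.le_sup (f := id) h
  have h2 : k ≤ k * d := Nat.le_mul_of_pos_right k hd
  omega

/-- The `d`-symbol `(X_0, ..., X_{d-1})` of a `β`-set `X`. -/
def toSymbol (d : ℕ) (X : Finset ℕ) : Fin d → Finset ℕ :=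
  fun j => component d X j

/-- The `β`-set of a `d`-symbol. -/
def ofSymbol {d : ℕ} (S : Fin d → Finset ℕ) : Finset ℕ :=
  Finset.univ.biUnion fun j : Fin d => (S j).image fun k => (j : ℕ) + k * d

/-- `ofSymbol` is inverse to `toSymbol`. -/
theorem toSymbol_eq_iff {d : ℕ} (hd : 0 < d) (X : Finset ℕ) (S : Fin d → Finset ℕ) :
    toSymbol d X = S ↔ X = ofSymbol S := by
  have key : ∀ (T : Fin d → Finset ℕ) (j : Fin d) (k : ℕ),
      (j : ℕ) + k * d ∈ ofSymbol T ↔ k ∈ T j := by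
    intro T j k
    simp only [ofSymbol, Finset.mem_biUnion, Finset.mem_univ, true_and, Finset.mem_image]
    constructor
    · rintro ⟨i, m, hm, h⟩
      have h1 := congrArg (· % d) h
      have h2 := congrArg (· / d) h
      simp only [Nat.add_mul_mod_self_right, Nat.mod_eq_of_lt i.2, Nat.mod_eq_of_lt j.2,
        Nat.add_mul_div_right _ _ hd, Nat.div_eq_of_lt i.2, Nat.div_eq_of_lt j.2, zero_add] at h1 h2
      rw [← Fin.ext h1, ← h2]
      exact hm
    · exact fun h => ⟨j, k, h, rfl⟩
  constructor
  · rintro rfl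
    ext a
    have h := key (toSymbol d X) ⟨a % d, Nat.mod_lt a hd⟩ (a / d)
    rw [show toSymbol d X ⟨a % d, Nat.mod_lt a hd⟩ = component d X (a % d) from rfl,
      mem_component hd] at h
    simp only [mul_comm (a / d) d, Nat.mod_add_div] at h
    exact h.symm
  · rintro rfl
    funext j
    ext k
    exact (mem_component hd).trans (key S j k)

/-- The `β`-set of cardinality `r` for a partition `κ` with at most `r` parts. -/
def ofPartition (r : ℕ) (κ : YoungDiagram) : Finset ℕ :=
  (Finset.range r).image fun k => κ.rowLen k + (r - 1 - k)

/-- The balanced `d`-symbol of a `d`-tuple of partitions: all its components are `β`-sets of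
cardinality `r`, where `r` is the maximal number of parts of the given partitions. -/
def balancedSymbol {d : ℕ} (κ : Fin d → YoungDiagram) : Fin d → Finset ℕ :=
  fun i => ofPartition (Finset.univ.sup fun j => (κ j).colLen 0) (κ i)

/-- The `d`-quotient `Q_d(X)` of a `β`-set. -/
def quotient (d : ℕ) (X : Finset ℕ) : Finset ℕ :=
  ofSymbol (balancedSymbol fun j => partition (toSymbol d X j))

/-- The `d`-quotient partition `q_d(X)` of a `β`-set. -/
def quotientPartition (d : ℕ) (X : Finset ℕ) : YoungDiagram :=
  partition (quotient d X)

/-- The modified length `h(z) + (x_i - x_j) d` of the hook `z` of the `d`-quotient partition of `X`,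
where `x_k` is the number of elements of the component `X_k`, the hand residue of `z` is `i`, and
`j` is the number in `{0, ..., d - 1}` such that the foot residue of `z` is `j + 1` modulo `d`. -/
def modifiedHookLength (d : ℕ) (X : Finset ℕ) (z : ℕ × ℕ) : ℤ :=
  let q := quotientPartition d X
  let i := q.handResidue d z
  let j := (q.footResidue d z + (d - 1)) % d
  (q.hookLength z : ℤ) + (((component d X i).card : ℤ) - ((component d X j).card : ℤ)) * (d : ℤ)

/-- The multiset of the modified lengths of all hooks of the `d`-quotient partition of `X`. -/
def modifiedHookLengths (d : ℕ) (X : Finset ℕ) : Multiset ℤ :=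
  (quotientPartition d X).cells.val.map (modifiedHookLength d X)

end BetaSet

/-! Place a bead at the content of the last node of every row, with empty rows included. Hooks of a
partition then correspond to pairs of a bead `a` and a hole `b < a`, and the length is `a - b`. Let
`φ = shift d X` move runner `i` of the `d`-abacus up by `x_i` places, and let `N` be the bead set of
the quotient partition. Up to a translation by `X.card`, the beads of `λ` are `φ(N)` and those of
the core are `φ` of the negative integers. The modified length of the hook with bead `a` and hole
`b` is `φ(a) - φ(b)`.

Fix `l > 0` and let `σ` be the permutation with `φ(σ n) = φ(n) - l`. Hooks of length `l` in `λ` are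
the `n ∈ N` with `σ n ∉ N`; in the core they are the `n < 0` with `σ n ≥ 0`. Modified lengths `l`
and `-l` come from the `n` with `n ∈ N`, `σ n ∉ N`, `σ n < n` and with `σ n ∈ N`, `n ∉ N`, `n < σ
n`. Where `σ n < n` the contributions cancel pointwise. Where `n < σ n` they leave `e(n) - e(σ n)`,
with `e` the indicator of `N` minus that of the negatives (`excess`). The set `D` of these `n`, and
also `σ(D)`, is invariant under translation by `d`, and `e` sums to zero along every runner since
the quotient is balanced. So the total defect vanishes (`finsum_indicator_excess_sub`,
`count_hookLengths_eq_add`). -/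

/-! ### Beads, holes and hook lengths -/

namespace YoungDiagram

/-- The bead of row `i`: the content of its last node (or `-i - 1` for an empty row). -/
def rowBead (μ : YoungDiagram) (i : ℕ) : ℤ := (μ.rowLen i : ℤ) - i - 1

/-- The hole of column `j`. -/
def colHole (μ : YoungDiagram) (j : ℕ) : ℤ := (j : ℤ) - μ.colLen j

/-- The beads of the (infinite) abacus of charge `0` of a Young diagram. -/
def beads (μ : YoungDiagram) : Set ℤ := Set.range μ.rowBead

theorem mem_iff_lt_both (μ : YoungDiagram) (i j : ℕ) :
    ((i, j) ∈ μ ∧ j < μ.rowLen i ∧ i < μ.colLen j) ∨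
      ((i, j) ∉ μ ∧ μ.rowLen i ≤ j ∧ μ.colLen j ≤ i) := by
  by_cases h : (i, j) ∈ μ
  · exact Or.inl ⟨h, mem_iff_lt_rowLen.1 h, mem_iff_lt_colLen.1 h⟩
  · exact Or.inr ⟨h, not_lt.1 (mt mem_iff_lt_rowLen.2 h), not_lt.1 (mt mem_iff_lt_colLen.2 h)⟩

/-- The difference bead minus hole is `(rowLen i - j) + (colLen j - i) - 1` in the integers. Both
brackets are positive at a cell and both are at most zero elsewhere, so the difference is never
zero. -/
theorem mem_iff_colHole_lt_rowBead (μ : YoungDiagram) (i j : ℕ) :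
    (i, j) ∈ μ ↔ μ.colHole j < μ.rowBead i := by
  unfold colHole rowBead
  rcases μ.mem_iff_lt_both i j with h | h <;> simp only [h.1, true_iff, false_iff] <;> omega

theorem rowBead_ne_colHole (μ : YoungDiagram) (i j : ℕ) : μ.rowBead i ≠ μ.colHole j := by
  unfold colHole rowBead
  rcases μ.mem_iff_lt_both i j with h | h <;> omega

theorem colHole_notMem_beads (μ : YoungDiagram) (j : ℕ) : μ.colHole j ∉ μ.beads := by
  rintro ⟨i, hi⟩
  exact μ.rowBead_ne_colHole i j hi

theorem rowBead_strictAnti (μ : YoungDiagram) : StrictAnti μ.rowBead := by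
  intro i j h
  have := μ.rowLen_anti i j h.le
  unfold rowBead
  omega

theorem colHole_strictMono (μ : YoungDiagram) : StrictMono μ.colHole := by
  intro i j h
  have := μ.colLen_anti i j h.le
  unfold colHole
  omega

theorem exists_colHole_eq (μ : YoungDiagram) {n : ℤ} (hn : n ∉ μ.beads) :
    ∃ j, μ.colHole j = n := by
  -- The least such row `i` is the number of beads `≥ n`. The column sought has length `i`, hence
  -- index `n + i`.
  have hex : ∃ i : ℕ, (μ.rowLen i : ℤ) - i ≤ n := by
    refine ⟨μ.rowLen 0 + n.natAbs, ?_⟩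
    have := μ.rowLen_anti 0 (μ.rowLen 0 + n.natAbs) (Nat.zero_le _)
    omega
  classical
  have h1 := Nat.find_spec hex
  have hmin := fun m => Nat.find_min hex (m := m)
  generalize Nat.find hex = i at h1 hmin
  refine ⟨(n + i).toNat, ?_⟩
  rcases μ.mem_iff_lt_both i (n + i).toNat with h | h
  · omega
  unfold colHole
  cases i with
  | zero => omega
  | succ i =>
    have h2 := hmin i (Nat.lt_succ_self i)
    have h3 : μ.rowBead i ≠ n := fun h => hn ⟨i, h⟩
    unfold rowBead at h3
    rcases μ.mem_iff_lt_both i (n + (i + 1 : ℕ)).toNat with h' | h' <;> omega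

theorem hookLength_eq {μ : YoungDiagram} {c : ℕ × ℕ} (hc : c ∈ μ) :
    (μ.hookLength c : ℤ) = μ.rowBead c.1 - μ.colHole c.2 := by
  unfold hookLength rowBead colHole
  rcases μ.mem_iff_lt_both c.1 c.2 with h | h
  · omega
  · exact absurd hc h.1

theorem image_cells (μ : YoungDiagram) (P : ℤ → ℤ → Prop)
    [DecidablePred fun c : ℕ × ℕ => P (μ.rowBead c.1) (μ.colHole c.2)] :
    (fun c : ℕ × ℕ => (μ.rowBead c.1, μ.colHole c.2)) ''
        (μ.cells.filter fun c => P (μ.rowBead c.1) (μ.colHole c.2) : Finset (ℕ × ℕ)) =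
      {p | p.1 ∈ μ.beads ∧ p.2 ∉ μ.beads ∧ p.2 < p.1 ∧ P p.1 p.2} := by
  ext ⟨a, b⟩
  simp only [Set.mem_image, Finset.coe_filter, mem_cells, Set.mem_ofPred_eq, Prod.mk.injEq]
  constructor
  · rintro ⟨⟨i, j⟩, ⟨h1, h2⟩, rfl, rfl⟩
    exact ⟨⟨i, rfl⟩, μ.colHole_notMem_beads j, (μ.mem_iff_colHole_lt_rowBead i j).1 h1, h2⟩
  · rintro ⟨⟨i, rfl⟩, hb, hlt, hP⟩
    obtain ⟨j, rfl⟩ := μ.exists_colHole_eq hb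
    exact ⟨(i, j), ⟨(μ.mem_iff_colHole_lt_rowBead i j).2 hlt, hP⟩, rfl, rfl⟩

theorem finite_pairs (μ : YoungDiagram) (P : ℤ → ℤ → Prop) :
    {p : ℤ × ℤ | p.1 ∈ μ.beads ∧ p.2 ∉ μ.beads ∧ p.2 < p.1 ∧ P p.1 p.2}.Finite := by
  classical
  rw [← μ.image_cells P]
  exact (Finset.finite_toSet _).image _

/-- The predicate is arbitrary because two are needed: a prescribed difference, and a prescribed
absolute difference after the runner shift. -/
theorem card_filter_cells (μ : YoungDiagram) (P : ℤ → ℤ → Prop)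
    [DecidablePred fun c : ℕ × ℕ => P (μ.rowBead c.1) (μ.colHole c.2)] :
    (μ.cells.filter fun c => P (μ.rowBead c.1) (μ.colHole c.2)).card =
      {p : ℤ × ℤ | p.1 ∈ μ.beads ∧ p.2 ∉ μ.beads ∧ p.2 < p.1 ∧ P p.1 p.2}.ncard := by
  rw [← μ.image_cells P, Set.ncard_image_of_injective, Set.ncard_coe_finset]
  rintro ⟨i, j⟩ ⟨i', j'⟩ h
  simp only [Prod.mk.injEq] at h
  exact Prod.ext (μ.rowBead_strictAnti.injective h.1) (μ.colHole_strictMono.injective h.2)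

theorem beads_pairs_eq_image (μ : YoungDiagram) {l : ℤ} (hl : 0 < l) :
    {p : ℤ × ℤ | p.1 ∈ μ.beads ∧ p.2 ∉ μ.beads ∧ p.2 < p.1 ∧ p.1 - p.2 = l} =
      (fun n => (n, n - l)) '' {n | n ∈ μ.beads ∧ n - l ∉ μ.beads} := by
  ext ⟨a, b⟩
  simp only [Set.mem_ofPred_eq, Set.mem_image, Prod.mk.injEq]
  constructor
  · rintro ⟨h1, h2, h3, h4⟩
    obtain rfl : b = a - l := by omega
    exact ⟨a, ⟨h1, h2⟩, rfl, rfl⟩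
  · rintro ⟨n, ⟨h1, h2⟩, rfl, rfl⟩
    exact ⟨h1, h2, by omega, by omega⟩

theorem finite_beads_diff (μ : YoungDiagram) {l : ℤ} (hl : 0 < l) :
    {n | n ∈ μ.beads ∧ n - l ∉ μ.beads}.Finite := by
  have h := μ.finite_pairs fun a b => a - b = l
  rw [μ.beads_pairs_eq_image hl] at h
  exact h.of_finite_image fun a _ b _ h => (Prod.mk.inj h).1

theorem count_hookLengths (μ : YoungDiagram) {l : ℕ} (hl : 0 < l) :
    μ.hookLengths.count l = {n | n ∈ μ.beads ∧ n - (l : ℤ) ∉ μ.beads}.ncard := by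
  classical
  have h := μ.card_filter_cells fun a b => a - b = l
  rw [μ.beads_pairs_eq_image (by omega), Set.ncard_image_of_injective _
    fun a b h => (Prod.mk.inj h).1] at h
  rw [← h, hookLengths, Multiset.count_map, ← Finset.filter_val, Finset.card_val]
  congr 1
  refine Finset.filter_congr fun c hc => ?_
  have := hookLength_eq ((mem_cells c).1 hc)
  omega

theorem count_zero_hookLengths (μ : YoungDiagram) : μ.hookLengths.count 0 = 0 := by
  simp [hookLengths, hookLength]

theorem exists_hook_of_beads {μ : YoungDiagram} {n : ℤ} {l : ℕ} (hl : 0 < l)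
    (h1 : n ∈ μ.beads) (h2 : n - l ∉ μ.beads) : ∃ c ∈ μ, μ.hookLength c = l := by
  obtain ⟨i, rfl⟩ := h1
  obtain ⟨j, hj⟩ := μ.exists_colHole_eq h2
  have hm : (i, j) ∈ μ := (μ.mem_iff_colHole_lt_rowBead i j).2 (by omega)
  have := hookLength_eq hm
  exact ⟨(i, j), hm, by simp only at this; omega⟩

/-! ### Hook removal as a bead move -/

theorem mem_removeHook {μ : YoungDiagram} {c x : ℕ × ℕ} :
    x ∈ μ.removeHook c ↔ x ∈ μ ∧ ¬ (c.1 ≤ x.1 ∧ c.2 ≤ x.2 ∧ (x.1 + 1, x.2 + 1) ∉ μ) := by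
  rw [← mem_cells]
  simp [removeHook]

theorem rowLen_eq_of_forall {μ : YoungDiagram} {i m : ℕ} (h : ∀ j, (i, j) ∈ μ ↔ j < m) :
    μ.rowLen i = m := by
  apply le_antisymm <;> by_contra! hlt
  · exact absurd ((h m).1 (mem_iff_lt_rowLen.2 hlt)) (lt_irrefl _)
  · exact absurd (mem_iff_lt_rowLen.1 ((h _).2 hlt)) (lt_irrefl _)

/-- Each row of the hook above the foot becomes the next row less one node. The `min` serves both
the foot row, which is cut at column `c.2`, and the rows below it, which are already that short. -/
theorem rowLen_removeHook {μ : YoungDiagram} {c : ℕ × ℕ} (i : ℕ) :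
    (μ.removeHook c).rowLen i =
      if i < c.1 then μ.rowLen i else
        if i + 1 < μ.colLen c.2 then μ.rowLen (i + 1) - 1 else min (μ.rowLen i) c.2 := by
  obtain ⟨i₀, j₀⟩ := c
  refine rowLen_eq_of_forall fun j => ?_
  have hanti := μ.rowLen_anti i (i + 1) (Nat.le_succ i)
  have h1 := μ.mem_iff_lt_both (i + 1) j₀
  rw [mem_removeHook]
  simp only [mem_iff_lt_rowLen]
  simp only [mem_iff_lt_rowLen] at h1
  split_ifs <;> omega

/-- Each row from the hand to just above the foot inherits the bead of the next row, and the foot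
row receives the former hole. In total, one bead jumps from the hand into the hole. -/
theorem beads_removeHook {μ : YoungDiagram} {c : ℕ × ℕ} (hc : c ∈ μ) (n : ℤ) :
    n ∈ (μ.removeHook c).beads ↔
      (n ∈ μ.beads ∧ n ≠ μ.rowBead c.1) ∨ n = μ.colHole c.2 := by
  obtain ⟨i₀, j₀⟩ := c
  have hc' : i₀ < μ.colLen j₀ := mem_iff_lt_colLen.1 hc
  have key : ∀ i, (μ.removeHook (i₀, j₀)).rowBead i =
      if i < i₀ then μ.rowBead i else if i + 1 < μ.colLen j₀ then μ.rowBead (i + 1) else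
        if i + 1 = μ.colLen j₀ then μ.colHole j₀ else μ.rowBead i := by
    intro i
    have h1 := μ.mem_iff_lt_both (i + 1) j₀
    have h2 := μ.mem_iff_lt_both i j₀
    simp only [rowBead, rowLen_removeHook, colHole]
    split_ifs <;> omega
  constructor
  · rintro ⟨i, rfl⟩
    rw [key]
    have hne : ∀ i', i' ≠ i₀ → μ.rowBead i' ≠ μ.rowBead i₀ :=
      fun i' h h' => h (μ.rowBead_strictAnti.injective h')
    split_ifs
    · exact Or.inl ⟨⟨_, rfl⟩, hne _ (by omega)⟩
    · exact Or.inl ⟨⟨_, rfl⟩, hne _ (by omega)⟩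
    · exact Or.inr rfl
    · exact Or.inl ⟨⟨_, rfl⟩, hne _ (by omega)⟩
  · rintro (⟨⟨i, rfl⟩, hne⟩ | rfl)
    · have hi : i ≠ i₀ := fun h => hne (h ▸ rfl)
      by_cases h : i₀ < i ∧ i < μ.colLen j₀
      · refine ⟨i - 1, ?_⟩
        rw [key, if_neg (by omega), if_pos (by omega), Nat.sub_add_cancel (by omega)]
      · refine ⟨i, ?_⟩
        rw [key]
        split_ifs <;> first | rfl | omega
    · refine ⟨μ.colLen j₀ - 1, ?_⟩
      rw [key, if_neg (by omega), if_neg (by omega), if_pos (by omega)]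

end YoungDiagram

/-! ### Abaci of β-sets and their runners -/

namespace BetaSet

/-- The infinite abacus of a `β`-set: all negative integers are added as beads. -/
def abacus (X : Finset ℕ) : Set ℤ := {n | n < 0 ∨ n.toNat ∈ X}

theorem mem_abacus {X : Finset ℕ} {n : ℤ} : n ∈ abacus X ↔ n < 0 ∨ n.toNat ∈ X := Iff.rfl

theorem natCast_mem_abacus {X : Finset ℕ} {n : ℕ} : (n : ℤ) ∈ abacus X ↔ n ∈ X := by
  simp [abacus]

theorem card_filter_lt_sort (X : Finset ℕ) {i : ℕ} (hi : i < (X.sort (· ≥ ·)).length) :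
    (X.filter (· < (X.sort (· ≥ ·))[i])).card = X.card - (i + 1) := by
  have hlen : (X.sort (· ≥ ·)).length = X.card := X.length_sort _
  have hanti : ∀ a b (ha : a < (X.sort (· ≥ ·)).length) (hb : b < (X.sort (· ≥ ·)).length),
      a < b → (X.sort (· ≥ ·))[b] < (X.sort (· ≥ ·))[a] := fun a b ha hb h =>
    List.pairwise_iff_getElem.1 (X.sortedGT_sort.pairwise) a b ha hb h
  have h : X.filter (· < (X.sort (· ≥ ·))[i]) =
      (Finset.Ico (i + 1) X.card).image fun k => (X.sort (· ≥ ·)).getD k 0 := by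
    ext x
    simp only [Finset.mem_filter, Finset.mem_image, Finset.mem_Ico]
    constructor
    · rintro ⟨hx, hlt⟩
      obtain ⟨k, hk, rfl⟩ := List.getElem_of_mem ((X.mem_sort (· ≥ ·)).2 hx)
      refine ⟨k, ⟨?_, hlen ▸ hk⟩, List.getD_eq_getElem _ _ hk⟩
      by_contra! hle
      rcases eq_or_lt_of_le (Nat.lt_succ_iff.1 hle) with rfl | h
      · exact lt_irrefl _ hlt
      · exact lt_asymm hlt (hanti k i hk hi h)
    · rintro ⟨k, ⟨h1, h2⟩, rfl⟩
      rw [List.getD_eq_getElem _ _ (hlen ▸ h2)]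
      exact ⟨(X.mem_sort (· ≥ ·)).1 (List.getElem_mem _), hanti i k hi (hlen ▸ h2) h1⟩
  rw [h, Finset.card_image_of_injOn, Nat.card_Ico]
  intro a ha b hb hab
  simp only [Finset.coe_Ico, Set.mem_Ico] at ha hb
  simp only [List.getD_eq_getElem _ _ (hlen ▸ ha.2), List.getD_eq_getElem _ _ (hlen ▸ hb.2)] at hab
  rcases lt_trichotomy a b with h | h | h
  · exact absurd hab (hanti a b _ _ h).ne'
  · exact h
  · exact absurd hab (hanti b a _ _ h).ne

theorem card_filter_lt_le (X : Finset ℕ) (a : ℕ) : (X.filter (· < a)).card ≤ a := by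
  calc _ ≤ (Finset.range a).card := Finset.card_le_card fun x hx => by
        simpa using (Finset.mem_filter.1 hx).2
    _ = a := Finset.card_range a

theorem rowBead_partition_of_lt (X : Finset ℕ) {i : ℕ} (hi : i < (X.sort (· ≥ ·)).length) :
    (partition X).rowBead i = ((X.sort (· ≥ ·))[i] : ℤ) - X.card := by
  have hi' : i < ((X.sort (· ≥ ·)).map (part X)).length := by simpa using hi
  have h1 : (partition X).rowLen i = part X (X.sort (· ≥ ·))[i] :=
    (YoungDiagram.rowLen_ofRowLens ⟨i, hi'⟩).trans (by simp)
  have h2 := card_filter_lt_sort X hi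
  have h3 := card_filter_lt_le X (X.sort (· ≥ ·))[i]
  rw [X.length_sort] at hi
  rw [YoungDiagram.rowBead, h1, part]
  omega

theorem rowBead_partition_of_le (X : Finset ℕ) {i : ℕ} (hi : X.card ≤ i) :
    (partition X).rowBead i = -(i : ℤ) - 1 := by
  have h1 : (partition X).rowLen i = 0 := by
    refine YoungDiagram.rowLen_eq_of_forall fun j => ?_
    simp [partition, YoungDiagram.mem_ofRowLens, not_lt.2 hi]
  rw [YoungDiagram.rowBead, h1]
  omega

/-- The `i`-th largest element of `X` is the bead of row `i` raised by `X.card`; the empty rows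
below account for the negative integers. -/
theorem mem_beads_partition (X : Finset ℕ) (n : ℤ) :
    n ∈ (partition X).beads ↔ n + X.card ∈ abacus X := by
  rw [mem_abacus]
  have hlen : (X.sort (· ≥ ·)).length = X.card := X.length_sort _
  constructor
  · rintro ⟨i, rfl⟩
    rcases lt_or_ge i X.card with h | h
    · have hm : (X.sort (· ≥ ·))[i]'(hlen ▸ h) ∈ X := (X.mem_sort (· ≥ ·)).1 (List.getElem_mem _)
      rw [rowBead_partition_of_lt X (hlen ▸ h)]
      right
      simpa using hm
    · rw [rowBead_partition_of_le X h]
      left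
      omega
  · rintro (h | h)
    · refine ⟨(-n - 1).toNat, ?_⟩
      rw [rowBead_partition_of_le] <;> omega
    · rcases lt_or_ge (n + X.card) 0 with hn | hn
      · refine ⟨(-n - 1).toNat, ?_⟩
        rw [rowBead_partition_of_le] <;> omega
      obtain ⟨k, hk, hk'⟩ := List.getElem_of_mem ((X.mem_sort (· ≥ ·)).2 h)
      refine ⟨k, ?_⟩
      rw [rowBead_partition_of_lt X hk, hk']
      omega

theorem card_ofPartition (r : ℕ) (κ : YoungDiagram) : (ofPartition r κ).card = r := by
  rw [ofPartition, Finset.card_image_of_injOn, Finset.card_range]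
  intro a ha b hb hab
  simp only [Finset.coe_range, Set.mem_Iio] at ha hb
  apply κ.rowBead_strictAnti.injective
  unfold YoungDiagram.rowBead
  simp only at hab
  omega

theorem mem_abacus_ofPartition {r : ℕ} {κ : YoungDiagram} (h : κ.colLen 0 ≤ r) (n : ℤ) :
    n + r ∈ abacus (ofPartition r κ) ↔ n ∈ κ.beads := by
  have h0 : ∀ i, r ≤ i → κ.rowLen i = 0 := fun i hi => by
    have := κ.mem_iff_lt_both i 0
    omega
  simp only [mem_abacus, ofPartition, Finset.mem_image, Finset.mem_range]
  constructor
  · rintro (hn | ⟨k, hk, hk'⟩)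
    · refine ⟨(-n - 1).toNat, ?_⟩
      rw [YoungDiagram.rowBead, h0] <;> omega
    · rcases lt_or_ge (n + r) 0 with hn | hn
      · refine ⟨(-n - 1).toNat, ?_⟩
        rw [YoungDiagram.rowBead, h0] <;> omega
      refine ⟨k, ?_⟩
      rw [YoungDiagram.rowBead]
      omega
  · rintro ⟨i, rfl⟩
    rw [YoungDiagram.rowBead]
    rcases lt_or_ge i r with hi | hi
    · exact Or.inr ⟨i, hi, by omega⟩
    · rw [h0 i hi]
      left
      omega

theorem component_ofSymbol {d : ℕ} (hd : 0 < d) (S : Fin d → Finset ℕ) (j : Fin d) :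
    component d (ofSymbol S) j = S j :=
  congrFun ((toSymbol_eq_iff hd (ofSymbol S) S).2 rfl) j

theorem card_component {d : ℕ} (hd : 0 < d) (X : Finset ℕ) {i : ℕ} (hi : i < d) :
    (component d X i).card = (X.filter (· % d = i)).card := by
  refine Finset.card_bij (fun k _ => i + k * d) (fun k hk => ?_) (fun a _ b _ h => ?_)
    fun n hn => ?_
  · rw [Finset.mem_filter, Nat.add_mul_mod_self_right, Nat.mod_eq_of_lt hi]
    exact ⟨(mem_component hd).1 hk, rfl⟩
  · exact Nat.eq_of_mul_eq_mul_right hd (by omega)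
  · rw [Finset.mem_filter] at hn
    have h : i + n / d * d = n := by rw [← hn.2, mul_comm, Nat.mod_add_div]
    exact ⟨n / d, (mem_component hd).2 (h.symm ▸ hn.1), h⟩

theorem card_eq_sum_component {d : ℕ} (hd : 0 < d) (X : Finset ℕ) :
    X.card = ∑ i ∈ Finset.range d, (component d X i).card := by
  rw [Finset.card_eq_sum_card_fiberwise (f := (· % d)) (t := Finset.range d)
    fun x _ => by simpa using Nat.mod_lt x hd]
  exact Finset.sum_congr rfl fun i hi => (card_component hd X (Finset.mem_range.1 hi)).symm

theorem card_quotient {d : ℕ} (hd : 0 < d) (X : Finset ℕ) :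
    (quotient d X).card =
      d * Finset.univ.sup fun j => (partition (toSymbol d X j)).colLen 0 := by
  rw [card_eq_sum_component hd, Finset.sum_congr rfl (g := fun _ =>
    Finset.univ.sup fun j => (partition (toSymbol d X j)).colLen 0), Finset.sum_const,
    Finset.card_range, smul_eq_mul]
  intro i hi
  have h := component_ofSymbol hd (balancedSymbol fun j => partition (toSymbol d X j))
    ⟨i, Finset.mem_range.1 hi⟩
  rw [quotient]
  exact (congrArg Finset.card h).trans (card_ofPartition _ _)

/-- The padding by negative integers is compatible with runners: as `0 ≤ i < d`, the number `i + k
d` is negative exactly when `k` is. -/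
theorem mem_abacus_iff_component {d : ℕ} (hd : 0 < d) (X : Finset ℕ) (i : Fin d) (k : ℤ) :
    (i : ℤ) + k * d ∈ abacus X ↔ k ∈ abacus (component d X i) := by
  have hi : ((i : ℕ) : ℤ) < d := by exact_mod_cast i.2
  have hd' : (0 : ℤ) < d := by exact_mod_cast hd
  rcases lt_or_ge k 0 with hk | hk
  · have : (i : ℤ) + k * d < 0 := by nlinarith
    simp [mem_abacus, hk, this]
  · lift k to ℕ using hk
    have h : (i : ℤ) + k * d = ((i + k * d : ℕ) : ℤ) := by push_cast; rfl
    rw [h, natCast_mem_abacus, natCast_mem_abacus, mem_component hd]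

/-! ### The runner shift and the quotient partition -/

/-- The permutation of the integers that moves the runner of residue `i` by the number of elements
of the component `X_i`. -/
def shift (d : ℕ) (X : Finset ℕ) : ℤ ≃ ℤ where
  toFun n := n + (component d X (n % d).toNat).card * d
  invFun n := n - (component d X (n % d).toNat).card * d
  left_inv n := by simp
  right_inv n := by simp

theorem shift_apply (d : ℕ) (X : Finset ℕ) (n : ℤ) :
    shift d X n = n + (component d X (n % d).toNat).card * d := rfl

theorem shift_add_mul (d : ℕ) (X : Finset ℕ) (i : Fin d) (k : ℤ) :
    shift d X (i + k * d) = i + (k + (component d X i).card) * d := by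
  have hi : ((i : ℕ) : ℤ) < d := by exact_mod_cast i.2
  have h : (((i : ℤ) + k * d) % d).toNat = i := by
    rw [Int.add_mul_emod_self_right, Int.emod_eq_of_lt (by omega) hi, Int.toNat_natCast]
  rw [shift_apply, h]
  ring

theorem shift_add (d : ℕ) (X : Finset ℕ) (n : ℤ) : shift d X (n + d) = shift d X n + d := by
  rw [shift_apply, shift_apply, Int.add_emod_right]
  ring

theorem exists_eq_add_mul {d : ℕ} (hd : 0 < d) (n : ℤ) :
    ∃ (i : Fin d) (k : ℤ), n = i + k * d := by
  have h1 := Int.emod_nonneg n (b := d) (by omega)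
  have h2 := Int.emod_lt_of_pos n (b := d) (by omega)
  refine ⟨⟨(n % d).toNat, by omega⟩, n / d, ?_⟩
  have := Int.emod_add_mul_ediv n d
  rw [mul_comm (n / d)]
  simp only
  omega

/-- All `d` runners of `Q_d(X)` carry the same number `r` of elements. Normalizing by the total `d
r` therefore lowers each runner by `r` places without permuting runners, so runner `i` shows the
beads of `p(X_i)`, which is `X_i` lowered by `x_i`. -/
theorem mem_beads_quotientPartition {d : ℕ} (hd : 0 < d) (X : Finset ℕ) (n : ℤ) :
    n ∈ (quotientPartition d X).beads ↔ shift d X n ∈ abacus X := by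
  obtain ⟨i, k, rfl⟩ := exists_eq_add_mul hd n
  rw [shift_add_mul, mem_abacus_iff_component hd, quotientPartition, mem_beads_partition,
    card_quotient hd, ← mem_beads_partition]
  push_cast
  rw [mul_comm (d : ℤ), add_assoc, ← add_mul, mem_abacus_iff_component hd, quotient,
    component_ofSymbol hd, balancedSymbol, mem_abacus_ofPartition]
  · rfl
  · exact Finset.le_sup (f := fun j => (partition (toSymbol d X j)).colLen 0) (Finset.mem_univ i)

theorem modifiedHookLength_eq {d : ℕ} (hd : 0 < d) (X : Finset ℕ) {z : ℕ × ℕ}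
    (hz : z ∈ quotientPartition d X) :
    modifiedHookLength d X z = shift d X ((quotientPartition d X).rowBead z.1) -
      shift d X ((quotientPartition d X).colHole z.2) := by
  have h1 := YoungDiagram.mem_iff_lt_rowLen.1 hz
  have h2 := YoungDiagram.mem_iff_lt_colLen.1 hz
  simp only [modifiedHookLength, YoungDiagram.hookLength_eq hz, shift_apply]
  generalize quotientPartition d X = q at *
  have hh : q.handResidue d z = (q.rowBead z.1 % d).toNat := by
    rw [YoungDiagram.handResidue, YoungDiagram.residue, YoungDiagram.rowBead]
    congr 2
    simp only
    omega
  -- The foot node has content one more than the hole of its column, so the index `j` is the residue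
  -- of the hole itself.
  have hf : (q.footResidue d z + (d - 1)) % d = (q.colHole z.2 % d).toNat := by
    have h0 := Int.emod_nonneg (q.colHole z.2 + 1) (b := d) (by omega)
    have h : q.footResidue d z = ((q.colHole z.2 + 1) % d).toNat := by
      rw [YoungDiagram.footResidue, YoungDiagram.residue, YoungDiagram.colHole]
      congr 2
      simp only
      omega
    zify
    rw [h, Int.toNat_of_nonneg h0, Int.toNat_of_nonneg (Int.emod_nonneg _ (by omega)),
      Nat.cast_sub (by omega), Int.emod_add_emod]
    push_cast
    rw [show q.colHole z.2 + 1 + ((d : ℤ) - 1) = q.colHole z.2 + d by ring, Int.add_emod_right]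
  rw [hh, hf]
  ring

end BetaSet

/-! ### Auxiliary facts on finite sums and sets -/

theorem finsum_indicator_one {α : Type*} {S : Set α} (hS : S.Finite) :
    ∑ᶠ a, S.indicator (1 : α → ℤ) a = S.ncard := by
  classical
  rw [finsum_eq_sum_of_support_subset (s := hS.toFinset) _ (by simp),
    Set.ncard_eq_toFinset_card _ hS, Finset.sum_congr rfl (g := fun _ => 1) fun a ha => ?_]
  · simp
  · simp [(hS.mem_toFinset).1 ha]

theorem hasFiniteSupport_indicator {α : Type*} {S : Set α} (hS : S.Finite) (f : α → ℤ) :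
    Function.HasFiniteSupport (S.indicator f) :=
  hS.subset Set.support_indicator_subset

theorem Finset.eq_range_card_of_closed {Y : Finset ℕ} (h : ∀ k, k + 1 ∈ Y → k ∈ Y) :
    Y = Finset.range Y.card := by
  have hle : ∀ k ∈ Y, ∀ m ≤ k, m ∈ Y := by
    intro k hk m hm
    induction k, hm using Nat.le_induction with
    | base => exact hk
    | succ k _ ih => exact ih (h k hk)
  refine Finset.eq_of_subset_of_card_le (fun k hk => ?_) (by simp)
  have : Finset.range (k + 1) ⊆ Y := fun m hm =>
    hle k hk m (Nat.lt_succ_iff.1 (Finset.mem_range.1 hm))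
  simpa using Finset.card_le_card this

/-! ### The core on the abacus -/

namespace BetaSet

open YoungDiagram

/-- Removing a `d`-hook moves a bead from `m + d` to `m`, so it stays on its runner and the runner
counts are unchanged. -/
theorem exists_abacus_of_removesHook {d : ℕ} (hd : 0 < d) {X : Finset ℕ} {t : ℕ}
    {μ ν : YoungDiagram} (hμ : ∀ n, n ∈ μ.beads ↔ n + t ∈ abacus X) (h : RemovesHook d μ ν) :
    ∃ Y : Finset ℕ, (∀ i < d, (component d Y i).card = (component d X i).card) ∧
      ∀ n, n ∈ ν.beads ↔ n + t ∈ abacus Y := by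
  obtain ⟨⟨i, j⟩, hc, hl, rfl⟩ := h
  have hab := hookLength_eq hc
  have ha : μ.rowBead i ∈ μ.beads := ⟨i, rfl⟩
  have hb := μ.colHole_notMem_beads j
  have hbeads := beads_removeHook hc
  rw [hl] at hab
  simp only at hab hbeads
  generalize μ.rowBead i = a at *
  generalize μ.colHole j = b at *
  rw [hμ, mem_abacus] at ha hb
  push Not at hb
  -- The hole lies at a nonnegative position since every negative one is occupied.
  obtain ⟨m, hm⟩ := Int.eq_ofNat_of_zero_le hb.1
  obtain rfl : b = m - t := by omega
  obtain rfl : a = (m + d : ℕ) - t := by push_cast; omega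
  simp only [sub_add_cancel, Int.toNat_natCast] at ha hb
  replace ha : m + d ∈ X := ha.resolve_left (by omega)
  have hmX : m ∉ X := hb.2
  refine ⟨insert m (X.erase (m + d)), fun k hk => ?_, fun n => ?_⟩
  · rw [card_component hd _ hk, card_component hd _ hk, Finset.filter_insert, Finset.filter_erase]
    split_ifs with hmk
    · rw [Finset.card_insert_of_notMem (by simp [hmX]), Finset.card_erase_of_mem
        (by simp [ha, hmk]), Nat.sub_add_cancel]
      exact Finset.card_pos.2 ⟨m + d, by simp [ha, hmk]⟩
    · rw [Finset.erase_eq_of_notMem (by simp [hmk])]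
  · rw [hbeads, hμ]
    simp only [mem_abacus, Finset.mem_insert, Finset.mem_erase]
    constructor
    · rintro (⟨h | h, hne⟩ | h)
      · exact Or.inl h
      · rcases lt_or_ge (n + t) 0 with hn | hn
        · exact Or.inl hn
        · exact Or.inr (Or.inr ⟨by omega, h⟩)
      · exact Or.inr (Or.inl (by omega))
    · rintro (h | h | h)
      · exact Or.inl ⟨Or.inl h, by omega⟩
      · rcases lt_or_ge (n + t) 0 with hn | hn
        · exact Or.inl ⟨Or.inl hn, by omega⟩
        · exact Or.inr (by omega)
      · exact Or.inl ⟨Or.inr h.2, by omega⟩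

theorem exists_abacus_of_removesHooks {d : ℕ} (hd : 0 < d) {X : Finset ℕ} {t : ℕ}
    {μ ν : YoungDiagram} (hμ : ∀ n, n ∈ μ.beads ↔ n + t ∈ abacus X)
    (h : Relation.ReflTransGen (RemovesHook d) μ ν) :
    ∃ Y : Finset ℕ, (∀ i < d, (component d Y i).card = (component d X i).card) ∧
      ∀ n, n ∈ ν.beads ↔ n + t ∈ abacus Y := by
  induction h with
  | refl => exact ⟨X, fun _ _ => rfl, hμ⟩
  | tail _ h ih =>
    obtain ⟨Y, hY, hν⟩ := ih
    obtain ⟨Z, hZ, h⟩ := exists_abacus_of_removesHook hd hν h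
    exact ⟨Z, fun i hi => (hZ i hi).trans (hY i hi), h⟩

/-- A gap below a bead on a runner would give a hook of length `d`. In the core, runner `i` is thus
filled exactly up to its count `x_i`, which is the image of the negative integers under the shift.
-/
theorem shift_mem_beads_core {d : ℕ} (hd : 0 < d) {X : Finset ℕ} {core : YoungDiagram}
    (h : IsCore d (partition X) core) (n : ℤ) :
    shift d X n - X.card ∈ core.beads ↔ n < 0 := by
  obtain ⟨Y, hY, hcore⟩ := exists_abacus_of_removesHooks hd (mem_beads_partition X) h.1
  obtain ⟨i, k, rfl⟩ := exists_eq_add_mul hd n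
  have hi : ((i : ℕ) : ℤ) < d := by exact_mod_cast i.2
  have hd' : (0 : ℤ) < d := by exact_mod_cast hd
  have hrange : component d Y i = Finset.range (component d X i).card := by
    rw [← hY i i.2]
    refine Finset.eq_range_card_of_closed fun k hk => ?_
    rw [mem_component hd, ← natCast_mem_abacus] at hk ⊢
    by_contra hk'
    obtain ⟨c, hc, hc'⟩ := exists_hook_of_beads (μ := core) (l := d)
      (n := (i + (k + 1) * d : ℕ) - X.card) hd (by rwa [hcore, sub_add_cancel])
      (by
        rw [hcore]
        convert hk' using 2
        push_cast
        ring)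
    exact h.2 c hc hc'
  rw [hcore, sub_add_cancel, shift_add_mul, mem_abacus_iff_component hd, hrange, mem_abacus,
    Finset.mem_range]
  constructor
  · intro hk
    have : k < 0 := by omega
    nlinarith
  · intro hk
    have : k < 0 := by
      by_contra! h0
      nlinarith [mul_nonneg h0 hd'.le]
    omega

/-! ### The excess and its vanishing sums -/

/-- The signed difference between the abacus of the quotient partition of `X` and the abacus of the
empty partition. -/
noncomputable def excess (d : ℕ) (X : Finset ℕ) : ℤ → ℤ :=
  (shift d X ⁻¹' abacus X).indicator 1 - (Set.Iio 0).indicator 1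

/-- Lowered by `Y.card`, the elements of `Y` are as numerous as the places `-Y.card, ..., -1` to be
filled; further down both sets are full. -/
theorem finsum_abacus_sub (Y : Finset ℕ) :
    ∑ᶠ k : ℤ, ((abacus Y).indicator 1 (k + Y.card) - (Set.Iio (0 : ℤ)).indicator 1 k : ℤ) = 0 := by
  classical
  set S : Finset ℤ := Y.image fun x : ℕ => (x : ℤ) - Y.card with hS
  have hcard : S.card = Y.card := Finset.card_image_of_injective _ fun a b h => by
    omega
  have h : ∀ k : ℤ, ((abacus Y).indicator 1 (k + Y.card) - (Set.Iio (0 : ℤ)).indicator 1 k : ℤ) =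
      (S : Set ℤ).indicator 1 k - (Set.Ico (-(Y.card : ℤ)) 0).indicator 1 k := by
    intro k
    have hk : k ∈ S ↔ 0 ≤ k + Y.card ∧ (k + Y.card).toNat ∈ Y := by
      simp only [hS, Finset.mem_image]
      constructor
      · rintro ⟨x, hx, rfl⟩
        simpa using hx
      · rintro ⟨h1, h2⟩
        exact ⟨_, h2, by omega⟩
    simp only [Set.indicator_apply, mem_abacus, Finset.mem_coe, hk, Set.mem_Iio, Set.mem_Ico]
    rcases lt_or_ge (k + Y.card) 0 with h1 | h1
    · have h2 : k < 0 := by omega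
      have h3 : ¬ -(Y.card : ℤ) ≤ k := by omega
      simp [h1, h2, h3, not_le.2 h1]
    · have h3 : -(Y.card : ℤ) ≤ k := by omega
      simp [h1, h3, not_lt.2 h1]
  rw [finsum_congr h, finsum_sub_distrib (hasFiniteSupport_indicator S.finite_toSet _)
    (hasFiniteSupport_indicator (Set.finite_Ico _ _) _), finsum_indicator_one S.finite_toSet,
    finsum_indicator_one (Set.finite_Ico _ _), Set.ncard_coe_finset, ← Finset.coe_Ico,
    Set.ncard_coe_finset, hcard]
  simp

theorem hasFiniteSupport_excess {d : ℕ} (hd : 0 < d) (X : Finset ℕ) :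
    Function.HasFiniteSupport (excess d X) := by
  refine (Set.finite_Icc (-((X.card : ℤ) * d)) (X.sup id : ℕ)).subset fun n hn => ?_
  by_contra hout
  refine hn ?_
  have h1 := Int.emod_nonneg n (b := d) (by omega)
  have h2 := Int.emod_lt_of_pos n (b := d) (by omega)
  have hle : ((component d X (n % d).toNat).card : ℤ) * d ≤ X.card * d := by
    rw [card_component hd X (by omega)]
    exact_mod_cast Nat.mul_le_mul_right d (Finset.card_filter_le _ _)
  have hge : (0 : ℤ) ≤ (component d X (n % d).toNat).card * d := by positivity
  have hshift := shift_apply d X n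
  rw [Set.mem_Icc, not_and_or, not_le, not_le] at hout
  rw [excess, Pi.sub_apply, sub_eq_zero]
  rcases hout with h | h
  -- Far below, the shift cannot lift `n` to a nonnegative position; far above, it only moves `n`
  -- further beyond the largest element of `X`.
  · rw [Set.indicator_of_mem, Set.indicator_of_mem] <;>
      first | rfl | exact Or.inl (by omega) | exact Set.mem_Iio.2 (by omega)
  · rw [Set.indicator_of_notMem, Set.indicator_of_notMem]
    · exact fun h' => absurd (Set.mem_Iio.1 h') (by omega)
    · rintro (h' | h')
      · omega
      · have := Finset.le_sup (f := id) h'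
        simp only [id] at this
        omega

theorem excess_add_mul {d : ℕ} (hd : 0 < d) (X : Finset ℕ) (i : Fin d) (k : ℤ) :
    excess d X (i + k * d) = (abacus (component d X i)).indicator 1 (k + (component d X i).card) -
      (Set.Iio (0 : ℤ)).indicator 1 k := by
  have hi : ((i : ℕ) : ℤ) < d := by exact_mod_cast i.2
  have hd' : (0 : ℤ) < d := by exact_mod_cast hd
  have h1 : (i : ℤ) + k * d < 0 ↔ k < 0 := by
    constructor
    · intro hk
      by_contra! h0
      nlinarith [mul_nonneg h0 hd'.le]
    · intro hk
      nlinarith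
  classical
  simp only [excess, Pi.sub_apply, Set.indicator_apply, Set.mem_preimage, shift_add_mul,
    mem_abacus_iff_component hd, Set.mem_Iio, h1, Pi.one_apply]

/-- A `d`-periodic set is a union of whole runners, and the excess sums to zero on each. -/
theorem finsum_indicator_excess {d : ℕ} (hd : 0 < d) (X : Finset ℕ) {D : Set ℤ}
    (hD : ∀ n : ℤ, n + d ∈ D ↔ n ∈ D) : ∑ᶠ n, D.indicator (excess d X) n = 0 := by
  have : NeZero d := ⟨hd.ne'⟩
  have hD' : ∀ (i k : ℤ), i + k * d ∈ D ↔ i ∈ D := by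
    intro i k
    induction k using Int.induction_on with
    | zero => simp
    | succ k ih => rw [← ih, ← hD (i + k * d)]; congr! 1; ring
    | pred k ih => rw [← ih, ← hD]; congr! 1; ring
  have hf : Function.HasFiniteSupport (D.indicator (excess d X)) :=
    (hasFiniteSupport_excess hd X).subset (by simp)
  set e := ((Int.divModEquiv d).trans (Equiv.prodComm ℤ (Fin d))).symm
  rw [← finsum_comp_equiv e, finsum_curry]
  · refine finsum_eq_zero_of_forall_eq_zero fun i => ?_
    have he : ∀ k, e (i, k) = i + k * d := fun k => by
      simp [e, Int.divModEquiv, add_comm]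
    simp only [he]
    by_cases h : (i : ℤ) ∈ D
    · rw [← finsum_abacus_sub (component d X i)]
      refine finsum_congr fun k => ?_
      rw [Set.indicator_of_mem ((hD' _ _).2 h), excess_add_mul hd]
    · refine finsum_eq_zero_of_forall_eq_zero fun k => ?_
      rw [Set.indicator_of_notMem (mt (hD' _ _).1 h)]
  · exact hf.preimage e.injective.injOn

end BetaSet

/-! ### Counting hooks of a given length -/

namespace BetaSet

open YoungDiagram

/-- The permutation `σ` of the integers with `shift d X (σ n) = shift d X n - l`. -/
def partner (d : ℕ) (X : Finset ℕ) (l : ℤ) : ℤ ≃ ℤ :=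
  ((shift d X).trans (Equiv.subRight l)).trans (shift d X).symm

theorem shift_partner (d : ℕ) (X : Finset ℕ) (l n : ℤ) :
    shift d X (partner d X l n) = shift d X n - l := by
  simp [partner]

theorem eq_partner_iff {d : ℕ} {X : Finset ℕ} {l m n : ℤ} :
    m = partner d X l n ↔ shift d X n - shift d X m = l := by
  rw [← (shift d X).injective.eq_iff, shift_partner]
  omega

theorem partner_add (d : ℕ) (X : Finset ℕ) (l n : ℤ) :
    partner d X l (n + d) = partner d X l n + d := by
  rw [eq_comm, eq_partner_iff, shift_add, shift_add, shift_partner]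
  ring

/-- The subtracted part, reindexed by `σ`, is the sum of the excess over the image of `{n | n < σ
n}`. Both sets are `d`-periodic because `σ` commutes with translation by `d`. -/
theorem finsum_indicator_excess_sub {d : ℕ} (hd : 0 < d) (X : Finset ℕ) (l : ℤ) :
    ∑ᶠ n, {n | n < partner d X l n}.indicator
      (fun n => excess d X n - excess d X (partner d X l n)) n = 0 := by
  set σ := partner d X l with hσ
  have h : ∀ n, {n | n < σ n}.indicator (fun n => excess d X n - excess d X (σ n)) n =
      {n | n < σ n}.indicator (excess d X) n -
        (σ.symm ⁻¹' {n | n < σ n}).indicator (excess d X) (σ n) := by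
    intro n
    classical
    simp only [Set.indicator_apply, Set.mem_preimage, Equiv.symm_apply_apply]
    split_ifs <;> simp
  have hf : ∀ D : Set ℤ, Function.HasFiniteSupport (D.indicator (excess d X)) := fun D =>
    (hasFiniteSupport_excess hd X).subset (by simp)
  have hper : ∀ n : ℤ, n + d ∈ {n | n < σ n} ↔ n ∈ {n | n < σ n} := fun n => by
    simp [hσ, partner_add]
  rw [finsum_congr h, finsum_sub_distrib (hf _) ((hf _).preimage σ.injective.injOn),
    finsum_indicator_excess hd X hper,
    finsum_comp_equiv σ (f := (σ.symm ⁻¹' {n | n < σ n}).indicator (excess d X)),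
    finsum_indicator_excess hd X, sub_zero]
  intro n
  obtain ⟨m, rfl⟩ := σ.surjective n
  have := hper m
  rw [hσ, Set.mem_preimage, ← partner_add, Equiv.symm_apply_apply, Set.mem_preimage,
    Equiv.symm_apply_apply]
  exact this

/-- Stated for general `N` to cover both `λ` (the beads of the quotient partition) and its core (the
negative integers). -/
theorem beads_diff_eq_image {d : ℕ} {X : Finset ℕ} {μ : YoungDiagram} {N : Set ℤ}
    (h : ∀ n, shift d X n - X.card ∈ μ.beads ↔ n ∈ N) (l : ℤ) :
    {n | n ∈ μ.beads ∧ n - l ∉ μ.beads} = ((shift d X).trans (Equiv.subRight (X.card : ℤ))) ''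
      {n | n ∈ N ∧ partner d X l n ∉ N} := by
  ext n
  rw [Equiv.image_eq_preimage_symm, Set.mem_preimage]
  obtain ⟨m, rfl⟩ := ((shift d X).trans (Equiv.subRight (X.card : ℤ))).surjective n
  rw [Equiv.symm_apply_apply]
  simp only [Equiv.trans_apply, Equiv.subRight_apply, Set.mem_ofPred_eq, ← h, shift_partner]
  rw [sub_right_comm]

theorem finite_diff {d : ℕ} {X : Finset ℕ} {μ : YoungDiagram} {N : Set ℤ}
    (h : ∀ n, shift d X n - X.card ∈ μ.beads ↔ n ∈ N) {l : ℤ} (hl : 0 < l) :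
    {n | n ∈ N ∧ partner d X l n ∉ N}.Finite := by
  have h1 := μ.finite_beads_diff hl
  rw [beads_diff_eq_image h] at h1
  exact h1.of_finite_image (Equiv.injective _).injOn

theorem count_hookLengths_eq_ncard {d : ℕ} {X : Finset ℕ} {μ : YoungDiagram} {N : Set ℤ}
    (h : ∀ n, shift d X n - X.card ∈ μ.beads ↔ n ∈ N) {l : ℕ} (hl : 0 < l) :
    μ.hookLengths.count l = {n | n ∈ N ∧ partner d X l n ∉ N}.ncard := by
  rw [μ.count_hookLengths hl, beads_diff_eq_image h, Set.ncard_image_of_injective _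
    (Equiv.injective _)]

/-- The two images correspond to the signs of the modified length: either the hole is the partner of
the bead, or the bead is the partner of the hole. -/
theorem pairs_eq_image_union (d : ℕ) (X : Finset ℕ) (N : Set ℤ) (l : ℕ) :
    {p : ℤ × ℤ | p.1 ∈ N ∧ p.2 ∉ N ∧ p.2 < p.1 ∧
        (shift d X p.1 - shift d X p.2).natAbs = l} =
      (fun n => (n, partner d X l n)) ''
          {n | n ∈ N ∧ partner d X l n ∉ N ∧ partner d X l n < n} ∪
        (fun n => (partner d X l n, n)) ''
          {n | partner d X l n ∈ N ∧ n ∉ N ∧ n < partner d X l n} := by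
  ext ⟨a, b⟩
  simp only [Set.mem_ofPred_eq, Set.mem_union, Set.mem_image, Prod.mk.injEq]
  constructor
  · rintro ⟨ha, hb, hlt, h⟩
    rcases Int.natAbs_eq_iff.1 h with h | h
    · obtain rfl := eq_partner_iff.2 h
      exact Or.inl ⟨a, ⟨ha, hb, hlt⟩, rfl, rfl⟩
    · obtain rfl : a = partner d X l b := eq_partner_iff.2 (by omega)
      exact Or.inr ⟨b, ⟨ha, hb, hlt⟩, rfl, rfl⟩
  · rintro (⟨n, ⟨h1, h2, h3⟩, rfl, rfl⟩ | ⟨n, ⟨h1, h2, h3⟩, rfl, rfl⟩)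
    · exact ⟨h1, h2, h3, by rw [shift_partner]; omega⟩
    · exact ⟨h1, h2, h3, by rw [shift_partner]; omega⟩

theorem finite_pairs_shift (d : ℕ) (X : Finset ℕ) (l : ℕ) :
    let q := (quotientPartition d X).beads
    {n | n ∈ q ∧ partner d X l n ∉ q ∧ partner d X l n < n}.Finite ∧
      {n | partner d X l n ∈ q ∧ n ∉ q ∧ n < partner d X l n}.Finite := by
  have h := (quotientPartition d X).finite_pairs
    fun a b => (shift d X a - shift d X b).natAbs = l
  rw [pairs_eq_image_union] at h
  obtain ⟨h1, h2⟩ := Set.finite_union.1 h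
  exact ⟨h1.of_finite_image fun a _ b _ h => (Prod.mk.inj h).1,
    h2.of_finite_image fun a _ b _ h => (Prod.mk.inj h).2⟩

theorem count_modifiedHookLengths {d : ℕ} (hd : 0 < d) (X : Finset ℕ) (l : ℕ) :
    let q := (quotientPartition d X).beads
    ((modifiedHookLengths d X).map Int.natAbs).count l =
      {n | n ∈ q ∧ partner d X l n ∉ q ∧ partner d X l n < n}.ncard +
        {n | partner d X l n ∈ q ∧ n ∉ q ∧ n < partner d X l n}.ncard := by
  intro q
  classical
  have h := (quotientPartition d X).card_filter_cells
    fun a b => (shift d X a - shift d X b).natAbs = l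
  obtain ⟨h1, h2⟩ := finite_pairs_shift d X l
  rw [pairs_eq_image_union, Set.ncard_union_eq ?_ (h1.image _) (h2.image _),
    Set.ncard_image_of_injective _ fun a b h => (Prod.mk.inj h).1,
    Set.ncard_image_of_injective _ fun a b h => (Prod.mk.inj h).2] at h
  · rw [← h, modifiedHookLengths, Multiset.map_map, Multiset.count_map, ← Finset.filter_val,
      Finset.card_val]
    congr 1
    refine Finset.filter_congr fun c hc => ?_
    rw [Function.comp_apply, modifiedHookLength_eq hd X ((mem_cells c).1 hc), eq_comm]
  · rw [Set.disjoint_left]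
    rintro _ ⟨n, ⟨h1, h2, h3⟩, rfl⟩ ⟨m, ⟨h4, h5, h6⟩, h⟩
    obtain ⟨h7, h8⟩ := Prod.mk.inj h
    have h9 := shift_partner d X l n
    have h10 := shift_partner d X l m
    rw [h7, h8] at h10
    -- A pair in both images satisfies `2 l = 0`, so `n` is its own partner, against `partner d X l
    -- n < n`.
    have : n = partner d X l n := (shift d X).injective (by omega)
    omega

theorem count_zero_modifiedHookLengths {d : ℕ} (hd : 0 < d) (X : Finset ℕ) :
    ((modifiedHookLengths d X).map Int.natAbs).count 0 = 0 := by
  rw [Multiset.count_eq_zero, modifiedHookLengths, Multiset.map_map, Multiset.mem_map]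
  rintro ⟨c, hc, h⟩
  rw [Function.comp_apply, modifiedHookLength_eq hd X ((mem_cells c).1 hc), Int.natAbs_eq_zero,
    sub_eq_zero] at h
  exact rowBead_ne_colHole _ _ _ ((shift d X).injective h)

theorem count_hookLengths_eq_add {d : ℕ} (hd : 0 < d) {X : Finset ℕ} {core : YoungDiagram}
    (hcore : IsCore d (partition X) core) {l : ℕ} (hl : 0 < l) :
    (partition X).hookLengths.count l =
      core.hookLengths.count l + ((modifiedHookLengths d X).map Int.natAbs).count l := by
  have hl' : (0 : ℤ) < l := by exact_mod_cast hl
  have hlam : ∀ n, shift d X n - X.card ∈ (partition X).beads ↔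
      n ∈ (quotientPartition d X).beads := fun n => by
    rw [mem_beads_partition, sub_add_cancel, mem_beads_quotientPartition hd]
  have hcore' : ∀ n, shift d X n - X.card ∈ core.beads ↔ n ∈ Set.Iio (0 : ℤ) :=
    shift_mem_beads_core hd hcore
  have hq : shift d X ⁻¹' abacus X = (quotientPartition d X).beads :=
    Set.ext fun n => (mem_beads_quotientPartition hd X n).symm
  have hsum := finsum_indicator_excess_sub hd X l
  obtain ⟨f3, f4⟩ := finite_pairs_shift d X l
  have f1 := finite_diff hlam hl'
  have f2 := finite_diff hcore' hl'
  rw [count_modifiedHookLengths hd, count_hookLengths_eq_ncard hlam hl,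
    count_hookLengths_eq_ncard hcore' hl]
  have hne : ∀ n, partner d X l n ≠ n := fun n h => by
    have := shift_partner d X l n
    rw [h] at this
    omega
  rw [excess, hq] at hsum
  generalize (quotientPartition d X).beads = N at *
  generalize partner d X l = σ at *
  -- If `σ n < n`, the core term vanishes and the first and third terms agree. If `n < σ n`, both
  -- the first minus the fourth term and the core term are differences of indicator values at `n`
  -- and `σ n`.
  have key : ∀ n, {n | n < σ n}.indicator (fun n =>
      (N.indicator 1 - (Set.Iio 0).indicator 1 : ℤ → ℤ) n -
        (N.indicator 1 - (Set.Iio 0).indicator 1 : ℤ → ℤ) (σ n)) n =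
      {n | n ∈ N ∧ σ n ∉ N}.indicator (1 : ℤ → ℤ) n -
        {n | n ∈ Set.Iio 0 ∧ σ n ∉ Set.Iio 0}.indicator (1 : ℤ → ℤ) n -
        {n | n ∈ N ∧ σ n ∉ N ∧ σ n < n}.indicator (1 : ℤ → ℤ) n -
        {n | σ n ∈ N ∧ n ∉ N ∧ n < σ n}.indicator (1 : ℤ → ℤ) n := by
    intro n
    have := hne n
    classical
    simp only [Set.indicator_apply, Pi.sub_apply, Pi.one_apply, Set.mem_ofPred_eq, Set.mem_Iio]
    by_cases h1 : n ∈ N <;> by_cases h2 : σ n ∈ N <;> rcases lt_or_gt_of_ne this with h3 | h3 <;>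
      simp only [h1, h2, h3, not_lt.2 h3.le, if_true, if_false, and_true,
        and_false, not_true, not_false_iff] <;> split_ifs <;> omega
  have g := fun {S : Set ℤ} (hS : S.Finite) => hasFiniteSupport_indicator hS 1
  have g2 : Function.HasFiniteSupport fun n => {n | n ∈ N ∧ σ n ∉ N}.indicator (1 : ℤ → ℤ) n -
      {n | n ∈ Set.Iio 0 ∧ σ n ∉ Set.Iio 0}.indicator (1 : ℤ → ℤ) n := (g f1).sub (g f2)
  have g3 : Function.HasFiniteSupport fun n => {n | n ∈ N ∧ σ n ∉ N}.indicator (1 : ℤ → ℤ) n -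
      {n | n ∈ Set.Iio 0 ∧ σ n ∉ Set.Iio 0}.indicator (1 : ℤ → ℤ) n -
      {n | n ∈ N ∧ σ n ∉ N ∧ σ n < n}.indicator (1 : ℤ → ℤ) n := g2.sub (g f3)
  rw [finsum_congr key, finsum_sub_distrib g3 (g f4),
    finsum_sub_distrib g2 (g f3), finsum_sub_distrib (g f1) (g f2),
    finsum_indicator_one f1, finsum_indicator_one f2, finsum_indicator_one f3,
    finsum_indicator_one f4] at hsum
  omega

end BetaSet

theorem theorem4p7 (d : ℕ) (hd : 0 < d) (lam core : YoungDiagram) (X : Finset ℕ)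
    (hX : BetaSet.partition X = lam) (hcore : YoungDiagram.IsCore d lam core) :
    lam.hookLengths =
      core.hookLengths + (BetaSet.modifiedHookLengths d X).map Int.natAbs := by
  subst hX
  ext l
  rw [Multiset.count_add]
  rcases Nat.eq_zero_or_pos l with rfl | hl
  · rw [YoungDiagram.count_zero_hookLengths, YoungDiagram.count_zero_hookLengths,
      BetaSet.count_zero_modifiedHookLengths hd]
  · exact BetaSet.count_hookLengths_eq_add hd hcore hl
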